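/- Let $q>0$ and let $m\ge 2$, $n$ be integers such that $n\ge 2m-1$ or $n>\tfrac{3m}{2}$. For $k\ge 1$ let $I_k(q)=\prod_{j=1}^{k}\sum_{i=0}^{j-1}q^i$. Let $\Sigma_n$ be a Mallows$(q)$ random permutation of $\{1,\dots,n\}$, i.e. $P(\Sigma_n=\sigma)=q^{\mathrm{inv}(\sigma)}/I_n(q)$ for every permutation $\sigma$, where $\mathrm{inv}(\sigma)$ is the number of pairs $i<j$ with $\sigma(i)>\sigma(j)$. Let $$W=\#\{\,1\le s\le n-m+1:\ \Sigma_n(s)\Sigma_n(s+1)\cdots\Sigma_n(s+m-1)\text{ is order-isomorphic to }12\cdots m\,\}$$ be the number of consecutive occurrences in $\Sigma_n$ of the increasing pattern $12\cdots m$, and let $Y$ be a Poisson random variable with expected value $\lambda=\mathbb{E}\,W$. Then $$\lambda=\frac{n-m+1}{I_m(q)}\qquad\text{and}\qquad d_{TV}(\mathcal{L}(W),\mathcal{L}(Y))\le 2(b_1+b_2),$$ where $d_{TV}(\mathcal{L}(W),\mathcal{L}(Y))=\frac12\sum_{k\ge0}|P(W=k)-P(Y=k)|$, $$b_1=\frac{n_1}{I_m(q)^2},\qquad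 b_2=n_2\sum_{s=1}^{m-1}\frac{1}{I_{2m-s}(q)},$$ $$n_1=2mn-3m^2+m,\qquad n_2=3m-3m^2-2n+2mn.$$ -/

import Mathlib

open MeasureTheory ProbabilityTheory
open scoped NNReal

noncomputable section

namespace MallowsPattern

/-- The inversion polynomial `I_n(q) = ∏_{j=1}^n ∑_{i=0}^{j-1} q^i`. -/
def invPoly (n : ℕ) (q : ℝ) : ℝ :=
  ∏ j ∈ Finset.Icc 1 n, ∑ i ∈ Finset.range j, q ^ i

/-- The number of inversions of `σ`, i.e. of pairs `i < j` with `σ i > σ j`. -/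
def numInv {n : ℕ} (σ : Equiv.Perm (Fin n)) : ℕ :=
  (Finset.univ.filter fun p : Fin n × Fin n => p.1 < p.2 ∧ σ p.2 < σ p.1).card

/-- `Sig` is a random permutation of `n` letters (a measurable map from `(Ω, P)` to the finite
discrete space of permutations) with the Mallows(`q`) distribution:
`P(Sig = σ) = q^{inv σ} / I_n(q)`. -/
structure IsMallows {Ω : Type*} [MeasurableSpace Ω] (P : Measure Ω) {n : ℕ} (q : ℝ)
    (Sig : Ω → Equiv.Perm (Fin n)) : Prop where
  measurableSet_eq : ∀ σ, MeasurableSet {ω | Sig ω = σ}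
  prob_eq : ∀ σ, P.real {ω | Sig ω = σ} = q ^ numInv σ / invPoly n q

/-- The reduction of a word `w` of length `m`: every letter is replaced by its rank among the
letters (counted from `0`). For words with distinct letters this is a permutation of `Fin m`. -/
def red {n m : ℕ} (w : Fin m → Fin n) (i : Fin m) : Fin m :=
  ⟨(Finset.univ.filter fun j => w j < w i).card, by
    have h : (Finset.univ.filter fun j => w j < w i).card < (Finset.univ : Finset (Fin m)).card :=
      Finset.card_lt_card (Finset.filter_ssubset.2 ⟨i, Finset.mem_univ i, lt_irrefl _⟩)
    simpa using h⟩

/-- The word `σ(s) σ(s+1) ⋯ σ(s+m-1)` of `m` consecutive values of `σ`. The starting positions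
`s` of blocks of `m` consecutive positions are indexed by `Fin (n + 1 - m)`. -/
def block {n : ℕ} (m : ℕ) (σ : Equiv.Perm (Fin n)) (s : Fin (n + 1 - m)) (j : Fin m) : Fin n :=
  σ ⟨s + j, by omega⟩

/-- The indicator that the pattern `τ` occurs in `σ` on the block of consecutive positions
starting at `s`. -/
def occ {n m : ℕ} (τ : Equiv.Perm (Fin m)) (σ : Equiv.Perm (Fin n)) (s : Fin (n + 1 - m)) : ℕ :=
  if red (block m σ s) = ⇑τ then 1 else 0

/-- The number of consecutive occurrences of the pattern `τ` in `σ`. -/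
def numOcc {n m : ℕ} (τ : Equiv.Perm (Fin m)) (σ : Equiv.Perm (Fin n)) : ℕ :=
  ∑ s : Fin (n + 1 - m), occ τ σ s

/-- The increasing pattern `1 2 ⋯ m`, i.e. the identity permutation. -/
def incPattern (m : ℕ) : Equiv.Perm (Fin m) := 1

/-- Total variation distance between two probability measures on `ℕ`. -/
def tvDist (μ ν : Measure ℕ) : ℝ :=
  (1 / 2) * ∑' k : ℕ, |μ.real {k} - ν.real {k}|

end MallowsPattern

end

noncomputable section
namespace MallowsPattern

/-! If `σ` is increasing on a block of `m` consecutive positions, permuting the letters of that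
block by `τ` adds exactly `inv τ` inversions. Since `∑ q ^ inv τ = I_m(q)`, the event that a block
is increasing has probability `1 / I_m(q)` and is independent of every quantity unchanged by
rearranging the block (`sum_pow_numInv_mul`). This gives `λ`, and independence of an occurrence from
all occurrences on disjoint blocks. Two increasing blocks at distance `d < m` share a position, so
together they form one increasing block of length `m + d`, of probability `1 / I_{m+d}(q)`.

The Stein–Chen method (`exists_stein_solution`, `stein_chen_le`) with overlapping blocks as
neighbourhoods then bounds the distance by a sum over pairs of overlapping blocks. With `N = n - m +
1`, `p = 1 / I_m` and `J_e = 1 / I_{m+e+1}` this sum is `N p² + 2 ∑ (N - e - 1)⁺ (p² + J_e)`.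

It remains to compare with `2 (b₁ + b₂)`. If `N ≥ m` the coefficients compare directly, except for
`m = 2`, `n = 3`, where `n₂ = 0` and the law of `W` is computed by hand. If `N < m`, the `p²` part
can exceed `2 b₁`; the excess is absorbed by `b₂`, because `I_{m+d} ≤ I_m²` for `3 d ≤ m`. -/

/-! ### The generating function of inversions. -/

theorem numInv_eq_sum {n : ℕ} (σ : Equiv.Perm (Fin n)) :
    numInv σ = ∑ i, ∑ j, if i < j ∧ σ j < σ i then 1 else 0 := by
  rw [numInv, Finset.card_filter, Fintype.sum_prod_type]

/-- The permutation with first letter `p` whose other letters are arranged as in `τ`. -/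
def insertFirst {n : ℕ} (p : Fin (n + 1)) (τ : Equiv.Perm (Fin n)) : Equiv.Perm (Fin (n + 1)) :=
  (finSuccEquiv' 0).trans ((Equiv.optionCongr τ).trans (finSuccEquiv' p).symm)

@[simp] theorem insertFirst_zero {n : ℕ} (p : Fin (n + 1)) (τ : Equiv.Perm (Fin n)) :
    insertFirst p τ 0 = p := by
  simp [insertFirst]

@[simp] theorem insertFirst_succ {n : ℕ} (p : Fin (n + 1)) (τ : Equiv.Perm (Fin n)) (i : Fin n) :
    insertFirst p τ i.succ = p.succAbove (τ i) := by
  have : finSuccEquiv' (0 : Fin (n + 1)) i.succ = some i := by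
    rw [← Fin.succAbove_zero_apply, finSuccEquiv'_succAbove]
  simp [insertFirst, this]

theorem insertFirst_bijective (n : ℕ) :
    Function.Bijective fun x : Fin (n + 1) × Equiv.Perm (Fin n) => insertFirst x.1 x.2 := by
  rw [Fintype.bijective_iff_injective_and_card]
  refine ⟨?_, by simp [Fintype.card_perm, Nat.factorial_succ]⟩
  rintro ⟨p, τ⟩ ⟨p', τ'⟩ h
  have hp : p = p' := by simpa using congrArg (fun σ => σ 0) h
  subst hp
  have hτ : τ = τ' := by
    ext i
    have := congrArg (fun σ => σ i.succ) h
    simp only [insertFirst_succ] at this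
    rw [Fin.succAbove_right_injective this]
  rw [hτ]

/-- The first letter `p` precedes exactly `p` smaller letters, and `Fin.succAbove` preserves the
order of the others. -/
theorem numInv_insertFirst {n : ℕ} (p : Fin (n + 1)) (τ : Equiv.Perm (Fin n)) :
    numInv (insertFirst p τ) = p + numInv τ := by
  have key : (∑ j : Fin n, if p.succAbove (τ j) < p then 1 else 0) = (p : ℕ) := by
    rw [Equiv.sum_comp τ fun j => if p.succAbove j < p then 1 else 0]
    have : (p : ℕ) = ∑ x : Fin (n + 1), if x < p then 1 else 0 := by
      rw [← Finset.card_filter, Finset.filter_gt_eq_Iio, Fin.card_Iio]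
    conv_rhs => rw [this, Fin.sum_univ_succAbove _ p]
    simp
  simp only [numInv_eq_sum, Fin.sum_univ_succ, insertFirst_zero, insertFirst_succ]
  simp only [lt_irrefl, false_and, if_false, Fin.succ_pos, true_and, Fin.not_lt_zero, zero_add,
    Fin.succ_lt_succ_iff, Fin.succAbove_lt_succAbove_iff]
  rw [key]

theorem sum_pow_numInv (n : ℕ) (q : ℝ) :
    ∑ σ : Equiv.Perm (Fin n), q ^ numInv σ = invPoly n q := by
  induction n with
  | zero => simp [invPoly, numInv]
  | succ n ih =>
    rw [← (Equiv.ofBijective _ (insertFirst_bijective n)).sum_comp]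
    simp only [Equiv.ofBijective_apply, numInv_insertFirst, pow_add]
    rw [Fintype.sum_prod_type]
    simp_rw [← Finset.mul_sum, ih]
    rw [← Finset.sum_mul, Fin.sum_univ_eq_sum_range (fun i => q ^ i), invPoly, invPoly,
      Finset.prod_Icc_succ_top (by omega), mul_comm]

theorem invPoly_pos (n : ℕ) {q : ℝ} (hq : 0 < q) : 0 < invPoly n q :=
  Finset.prod_pos fun j hj => Finset.sum_pos (fun _ _ => by positivity)
    ⟨0, Finset.mem_range.2 (Finset.mem_Icc.1 hj).1⟩

/-! ### Rearranging a block of consecutive positions. -/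

/-- `σ` is increasing on the `m` consecutive positions starting at `s`. -/
def IncOn {n : ℕ} (s m : ℕ) (σ : Equiv.Perm (Fin n)) : Prop :=
  ∀ j k : Fin n, s ≤ (j : ℕ) → j < k → (k : ℕ) < s + m → σ j < σ k

/-- The embedding of `m` consecutive positions starting at `s`. -/
def shiftEmb {n m s : ℕ} (h : s + m ≤ n) : Fin m ↪ Fin n :=
  ⟨fun j => ⟨s + j, by omega⟩, fun a b hab => by simpa [Fin.ext_iff] using hab⟩

theorem shiftEmb_val {n m s : ℕ} (h : s + m ≤ n) (j : Fin m) : (shiftEmb h j : ℕ) = s + j := rfl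

theorem shiftEmb_lt {n m s : ℕ} (h : s + m ≤ n) (a b : Fin m) :
    shiftEmb h a < shiftEmb h b ↔ a < b := by
  rw [Fin.lt_def, Fin.lt_def, shiftEmb_val, shiftEmb_val]; omega

theorem mem_range_shiftEmb {n m s : ℕ} (h : s + m ≤ n) (x : Fin n) :
    x ∈ Set.range (shiftEmb h) ↔ s ≤ (x : ℕ) ∧ (x : ℕ) < s + m := by
  constructor
  · rintro ⟨a, rfl⟩
    rw [shiftEmb_val]; omega
  · rintro ⟨h1, h2⟩
    exact ⟨⟨x - s, by omega⟩, Fin.ext (by rw [shiftEmb_val]; simp only; omega)⟩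

theorem incOn_iff {n m s : ℕ} (h : s + m ≤ n) (σ : Equiv.Perm (Fin n)) :
    IncOn s m σ ↔ StrictMono (σ ∘ shiftEmb h) := by
  constructor
  · intro H a b hab
    refine H _ _ ?_ ((shiftEmb_lt h a b).2 hab) ?_ <;> rw [shiftEmb_val] <;> omega
  · intro H j k hj hjk hk
    obtain ⟨a, rfl⟩ := (mem_range_shiftEmb h j).2 ⟨hj, by have := Fin.lt_def.1 hjk; omega⟩
    obtain ⟨b, rfl⟩ := (mem_range_shiftEmb h k).2 ⟨by have := Fin.lt_def.1 hjk; omega, hk⟩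
    exact H ((shiftEmb_lt h a b).1 hjk)

/-- The permutation of `n` positions that acts as `τ` on the block starting at `s`. -/
def blockPerm {n m s : ℕ} (h : s + m ≤ n) (τ : Equiv.Perm (Fin m)) : Equiv.Perm (Fin n) :=
  τ.viaFintypeEmbedding (shiftEmb h)

theorem blockPerm_shiftEmb {n m s : ℕ} (h : s + m ≤ n) (τ : Equiv.Perm (Fin m)) (a : Fin m) :
    blockPerm h τ (shiftEmb h a) = shiftEmb h (τ a) :=
  Equiv.Perm.viaFintypeEmbedding_apply_image ..

theorem blockPerm_of_notMem {n m s : ℕ} (h : s + m ≤ n) (τ : Equiv.Perm (Fin m)) {x : Fin n}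
    (hx : ¬ (s ≤ (x : ℕ) ∧ (x : ℕ) < s + m)) : blockPerm h τ x = x :=
  Equiv.Perm.viaFintypeEmbedding_apply_notMem_range _ _ (mt (mem_range_shiftEmb h x).1 hx)

theorem blockPerm_mem_iff {n m s : ℕ} (h : s + m ≤ n) (τ : Equiv.Perm (Fin m)) (x : Fin n) :
    (s ≤ (blockPerm h τ x : ℕ) ∧ (blockPerm h τ x : ℕ) < s + m) ↔
      (s ≤ (x : ℕ) ∧ (x : ℕ) < s + m) := by
  by_cases hx : s ≤ (x : ℕ) ∧ (x : ℕ) < s + m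
  · obtain ⟨a, rfl⟩ := (mem_range_shiftEmb h x).2 hx
    rw [blockPerm_shiftEmb, shiftEmb_val, shiftEmb_val]; omega
  · rw [blockPerm_of_notMem h τ hx]

theorem blockPerm_lt_iff {n m s : ℕ} (h : s + m ≤ n) (τ : Equiv.Perm (Fin m)) {x y : Fin n}
    (hxy : ¬ ((s ≤ (x : ℕ) ∧ (x : ℕ) < s + m) ∧ (s ≤ (y : ℕ) ∧ (y : ℕ) < s + m))) :
    blockPerm h τ x < blockPerm h τ y ↔ x < y := by
  have hx := blockPerm_mem_iff h τ x
  have hy := blockPerm_mem_iff h τ y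
  by_cases hx' : s ≤ (x : ℕ) ∧ (x : ℕ) < s + m
  · have hy' : ¬ (s ≤ (y : ℕ) ∧ (y : ℕ) < s + m) := fun h' => hxy ⟨hx', h'⟩
    rw [blockPerm_of_notMem h τ hy']
    simp only [Fin.lt_def]; omega
  · rw [blockPerm_of_notMem h τ hx']
    by_cases hy' : s ≤ (y : ℕ) ∧ (y : ℕ) < s + m
    · simp only [Fin.lt_def]; omega
    · rw [blockPerm_of_notMem h τ hy']

/-- Within the block `σ` has no inversions and the product has those of `τ`. The remaining pairs of
positions are permuted by `blockPerm` in both coordinates; the block is an interval, so this keeps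
their order. -/
theorem numInv_mul_blockPerm {n m s : ℕ} (h : s + m ≤ n) {σ : Equiv.Perm (Fin n)}
    (hσ : IncOn s m σ) (τ : Equiv.Perm (Fin m)) :
    numInv (σ * blockPerm h τ) = numInv σ + numInv τ := by
  classical
  let B : Fin n × Fin n → Prop := fun p =>
    (s ≤ (p.1 : ℕ) ∧ (p.1 : ℕ) < s + m) ∧ (s ≤ (p.2 : ℕ) ∧ (p.2 : ℕ) < s + m)
  have split : ∀ ρ : Equiv.Perm (Fin n), numInv ρ =
      (Finset.univ.filter fun p : Fin n × Fin n => (p.1 < p.2 ∧ ρ p.2 < ρ p.1) ∧ B p).card +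
      (Finset.univ.filter fun p : Fin n × Fin n => (p.1 < p.2 ∧ ρ p.2 < ρ p.1) ∧ ¬ B p).card := by
    intro ρ
    rw [numInv, ← Finset.card_filter_add_card_filter_not B, Finset.filter_filter,
      Finset.filter_filter]
  have h1 : (Finset.univ.filter fun p : Fin n × Fin n =>
      (p.1 < p.2 ∧ σ p.2 < σ p.1) ∧ B p).card = 0 := by
    rw [Finset.card_eq_zero, Finset.filter_eq_empty_iff]
    rintro ⟨x, y⟩ - ⟨⟨hxy, hyx⟩, hB⟩
    exact lt_asymm hyx (hσ x y hB.1.1 hxy hB.2.2)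
  have h2 : (Finset.univ.filter fun p : Fin n × Fin n =>
      (p.1 < p.2 ∧ (σ * blockPerm h τ) p.2 < (σ * blockPerm h τ) p.1) ∧ B p).card = numInv τ := by
    rw [numInv]
    symm
    refine Finset.card_bij (fun p _ => (shiftEmb h p.1, shiftEmb h p.2)) ?_ ?_ ?_
    · rintro ⟨a, b⟩ hab
      simp only [Finset.mem_filter, Finset.mem_univ, true_and] at hab
      refine Finset.mem_filter.2 ⟨Finset.mem_univ _, ⟨(shiftEmb_lt h a b).2 hab.1, ?_⟩, ?_⟩
      · simp only [Equiv.Perm.mul_apply, blockPerm_shiftEmb]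
        exact (incOn_iff h σ).1 hσ hab.2
      · exact ⟨(mem_range_shiftEmb h _).1 ⟨a, rfl⟩, (mem_range_shiftEmb h _).1 ⟨b, rfl⟩⟩
    · rintro ⟨a, b⟩ - ⟨c, d⟩ - hh
      simpa using hh
    · rintro ⟨x, y⟩ hxy
      simp only [Finset.mem_filter, Finset.mem_univ, true_and] at hxy
      obtain ⟨⟨hlt, hinv⟩, hx, hy⟩ := hxy
      obtain ⟨a, rfl⟩ := (mem_range_shiftEmb h x).2 hx
      obtain ⟨b, rfl⟩ := (mem_range_shiftEmb h y).2 hy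
      refine ⟨(a, b), ?_, rfl⟩
      simp only [Equiv.Perm.mul_apply, blockPerm_shiftEmb] at hinv
      simp only [Finset.mem_filter, Finset.mem_univ, true_and]
      exact ⟨(shiftEmb_lt h a b).1 hlt, ((incOn_iff h σ).1 hσ).lt_iff_lt.1 hinv⟩
  have h3 : (Finset.univ.filter fun p : Fin n × Fin n =>
      (p.1 < p.2 ∧ (σ * blockPerm h τ) p.2 < (σ * blockPerm h τ) p.1) ∧ ¬ B p).card =
      (Finset.univ.filter fun p : Fin n × Fin n => (p.1 < p.2 ∧ σ p.2 < σ p.1) ∧ ¬ B p).card := by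
    refine Finset.card_equiv ((blockPerm h τ).prodCongr (blockPerm h τ)) ?_
    rintro ⟨x, y⟩
    rw [Finset.mem_filter, Finset.mem_filter]
    simp only [Finset.mem_univ, true_and, Equiv.Perm.mul_apply,
      Equiv.prodCongr_apply, Prod.map, B, blockPerm_mem_iff]
    refine and_congr_left fun hB => and_congr_left fun _ => (blockPerm_lt_iff h τ hB).symm
  rw [split, split σ, h1, h2, h3]
  omega

theorem existsUnique_sort {n m : ℕ} (w : Fin m → Fin n) (hw : Function.Injective w) :
    ∃! τ : Equiv.Perm (Fin m), StrictMono (w ∘ τ) := by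
  refine ⟨Tuple.sort w, (Tuple.monotone_sort w).strictMono_of_injective
    (hw.comp (Equiv.injective _)), ?_⟩
  intro τ hτ
  have hs : StrictMono (w ∘ Tuple.sort w) := (Tuple.monotone_sort w).strictMono_of_injective
    (hw.comp (Equiv.injective _))
  have := (StrictMono.range_inj hτ hs).1 (by simp [Set.range_comp])
  ext i
  exact congrArg Fin.val (hw (congrFun this i))

open Classical in
/-- Summing a function that does not depend on the arrangement of the letters in a block, only the
arrangements that are increasing on the block need be considered. -/
theorem sum_pow_numInv_mul {n m s : ℕ} (h : s + m ≤ n) (q : ℝ) (F : Equiv.Perm (Fin n) → ℝ)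
    (hF : ∀ σ τ, F (σ * blockPerm h τ) = F σ) :
    ∑ σ, q ^ numInv σ * F σ =
      invPoly m q * ∑ σ, q ^ numInv σ * ((if IncOn s m σ then 1 else 0) * F σ) := by
  have hinv : ∀ (σ : Equiv.Perm (Fin n)) (τ : Equiv.Perm (Fin m)),
      IncOn s m (σ * (blockPerm h τ)⁻¹) ↔
        StrictMono ((σ ∘ shiftEmb h) ∘ (τ⁻¹ : Equiv.Perm _)) := by
    intro σ τ
    rw [incOn_iff h]
    have : (⇑(σ * (blockPerm h τ)⁻¹) ∘ shiftEmb h) =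
        ((σ ∘ shiftEmb h) ∘ (τ⁻¹ : Equiv.Perm _)) := by
      funext a
      have : (blockPerm h τ)⁻¹ (shiftEmb h a) = shiftEmb h (τ⁻¹ a) := by
        rw [Equiv.Perm.inv_eq_iff_eq, blockPerm_shiftEmb]; simp
      simp only [Function.comp_apply, Equiv.Perm.mul_apply, this]
    rw [this]
  -- Exactly one rearrangement sorts the block. Inserting this sum of indicators and translating `σ`
  -- by `blockPerm h τ` turns the weight into `q ^ numInv τ * q ^ numInv σ`, and the sum over `τ`
  -- factors out.
  have hone : ∀ σ : Equiv.Perm (Fin n),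
      ∑ τ : Equiv.Perm (Fin m), (if IncOn s m (σ * (blockPerm h τ)⁻¹) then (1 : ℝ) else 0) = 1 := by
    intro σ
    simp_rw [hinv]
    rw [← Equiv.sum_comp (Equiv.inv (Equiv.Perm (Fin m)))]
    simp only [Equiv.inv_apply, inv_inv]
    obtain ⟨τ, hτ, huniq⟩ := existsUnique_sort (σ ∘ shiftEmb h)
      (σ.injective.comp (shiftEmb h).injective)
    rw [Finset.sum_eq_single τ (fun b _ hb => if_neg fun hb' => hb (huniq b hb')) (by simp),
      if_pos hτ]
  calc ∑ σ, q ^ numInv σ * F σ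
      = ∑ σ, ∑ τ : Equiv.Perm (Fin m),
          (if IncOn s m (σ * (blockPerm h τ)⁻¹) then (1 : ℝ) else 0) * (q ^ numInv σ * F σ) := by
        simp_rw [← Finset.sum_mul, hone, one_mul]
    _ = ∑ τ : Equiv.Perm (Fin m), ∑ σ, (if IncOn s m σ then (1 : ℝ) else 0) *
          (q ^ numInv (σ * blockPerm h τ) * F (σ * blockPerm h τ)) := by
        rw [Finset.sum_comm]
        refine Finset.sum_congr rfl fun τ _ => ?_
        rw [← Equiv.sum_comp (Equiv.mulRight (blockPerm h τ))]
        simp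
    _ = ∑ τ : Equiv.Perm (Fin m), ∑ σ,
          q ^ numInv τ * (q ^ numInv σ * ((if IncOn s m σ then 1 else 0) * F σ)) := by
        refine Finset.sum_congr rfl fun τ _ => Finset.sum_congr rfl fun σ _ => ?_
        by_cases hσ : IncOn s m σ
        · rw [if_pos hσ, hF, numInv_mul_blockPerm h hσ, pow_add]; ring
        · simp [hσ]
    _ = _ := by
        simp_rw [← Finset.mul_sum]
        rw [← Finset.sum_mul, sum_pow_numInv]

/-- As `d < m`, position `s + d` lies in both windows, and comparisons across them pass through it.
-/
theorem incOn_and_incOn_iff {n s m d : ℕ} (hdm : d < m) (σ : Equiv.Perm (Fin n)) :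
    IncOn s m σ ∧ IncOn (s + d) m σ ↔ IncOn s (m + d) σ := by
  constructor
  · rintro ⟨h1, h2⟩ j k hj hjk hk
    have hjk' := Fin.lt_def.1 hjk
    by_cases hk' : (k : ℕ) < s + m
    · exact h1 j k hj hjk hk'
    by_cases hj' : s + d ≤ (j : ℕ)
    · exact h2 j k hj' hjk (by omega)
    have hl : s + d < n := by omega
    exact (h1 j ⟨s + d, hl⟩ hj (Fin.lt_def.2 (by simp only; omega)) (by simp only; omega)).trans
      (h2 ⟨s + d, hl⟩ k le_rfl (Fin.lt_def.2 (by simp only; omega)) (by omega))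
  · intro H
    exact ⟨fun j k hj hjk hk => H j k hj hjk (by omega),
      fun j k hj hjk hk => H j k (by omega) hjk (by omega)⟩

theorem incOn_mul_blockPerm_iff {n m s t : ℕ} (h : s + m ≤ n) (hst : s + m ≤ t ∨ t + m ≤ s)
    (σ : Equiv.Perm (Fin n)) (τ : Equiv.Perm (Fin m)) :
    IncOn t m (σ * blockPerm h τ) ↔ IncOn t m σ := by
  have key : ∀ x : Fin n, t ≤ (x : ℕ) → (x : ℕ) < t + m → blockPerm h τ x = x := fun x h1 h2 =>
    blockPerm_of_notMem h τ (by omega)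
  refine forall_congr' fun j => forall_congr' fun k => forall_congr' fun hj =>
    forall_congr' fun hjk => forall_congr' fun hk => ?_
  have := Fin.lt_def.1 hjk
  rw [Equiv.Perm.mul_apply, Equiv.Perm.mul_apply, key j hj (by omega), key k (by omega) hk]

theorem red_eq_id_iff {n m : ℕ} (w : Fin m → Fin n) :
    red w = ⇑(incPattern m) ↔ StrictMono w := by
  have hval : ∀ i, (red w i : ℕ) = (Finset.univ.filter fun j => w j < w i).card := fun i => rfl
  constructor
  · intro H i j hij
    by_contra hcon
    have hle : w j ≤ w i := not_lt.1 hcon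
    have : (red w j : ℕ) ≤ red w i := by
      rw [hval, hval]
      refine Finset.card_le_card fun k hk => ?_
      simp only [Finset.mem_filter, Finset.mem_univ, true_and] at hk ⊢
      exact hk.trans_le hle
    rw [H] at this
    simp only [incPattern, Equiv.Perm.one_apply] at this
    exact absurd (Fin.lt_def.1 hij) (not_lt.2 this)
  · intro H
    funext i
    apply Fin.ext
    rw [hval]
    simp only [incPattern, Equiv.Perm.one_apply, H.lt_iff_lt]
    rw [Finset.filter_gt_eq_Iio, Fin.card_Iio]

open Classical in
theorem occ_incPattern {n m : ℕ} (σ : Equiv.Perm (Fin n)) (s : Fin (n + 1 - m)) :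
    occ (incPattern m) σ s = if IncOn s m σ then 1 else 0 := by
  have hs : (s : ℕ) + m ≤ n := by omega
  have : red (block m σ s) = ⇑(incPattern m) ↔ IncOn s m σ := by
    rw [red_eq_id_iff, incOn_iff hs]; rfl
  simp only [occ, this]

/-! ### Total variation and Stein's method for the Poisson law. -/

theorem hasSum_indicator_real_singleton (μ : Measure ℕ) [IsFiniteMeasure μ] (A : Set ℕ) :
    HasSum (A.indicator fun k => μ.real {k}) (μ.real A) := by
  have h := Measure.tsum_indicator_apply_singleton μ A (MeasurableSet.of_discrete)
  have h' := ENNReal.hasSum_toReal (h ▸ measure_ne_top μ A)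
  rw [← ENNReal.tsum_toReal_eq (ENNReal.ne_top_of_tsum_ne_top (h ▸ measure_ne_top μ A)), h] at h'
  change HasSum _ (μ A).toReal
  convert h' using 1
  funext k
  by_cases hk : k ∈ A <;> simp [hk, Measure.real]

theorem tvDist_le_of_forall (μ ν : Measure ℕ) [IsProbabilityMeasure μ] [IsProbabilityMeasure ν]
    {c : ℝ} (h : ∀ A : Set ℕ, μ.real A - ν.real A ≤ c) : tvDist μ ν ≤ c := by
  -- On this set the difference is nonnegative, off it negative; as both total masses are 1, half
  -- the `ℓ¹` distance is attained at this set.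
  set A : Set ℕ := {k | ν.real {k} ≤ μ.real {k}} with hA
  have h1 := ((hasSum_indicator_real_singleton μ A).sub
    (hasSum_indicator_real_singleton ν A)).mul_left 2
  have hμ := hasSum_indicator_real_singleton μ Set.univ
  have hν := hasSum_indicator_real_singleton ν Set.univ
  simp only [Set.indicator_univ, probReal_univ] at hμ hν
  have h2 := h1.sub (hμ.sub hν)
  have h3 : (fun k => |μ.real {k} - ν.real {k}|) = fun k =>
      2 * (A.indicator (fun k => μ.real {k}) k - A.indicator (fun k => ν.real {k}) k) -
        (μ.real {k} - ν.real {k}) := by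
    funext k
    by_cases hk : k ∈ A
    · have : ν.real {k} ≤ μ.real {k} := hk
      rw [Set.indicator_of_mem hk, Set.indicator_of_mem hk, abs_of_nonneg (by linarith)]
      ring
    · have : μ.real {k} < ν.real {k} := not_le.1 hk
      rw [Set.indicator_of_notMem hk, Set.indicator_of_notMem hk, abs_of_neg (by linarith)]
      ring
  rw [tvDist, h3, h2.tsum_eq]
  have := h A
  linarith

/-- The Stein equation for a distribution `w` on `ℕ` satisfying the Poisson recursion has a
solution whose increments away from zero are bounded by one. -/
theorem exists_stein_solution {w : ℕ → ℝ} {r : ℝ} (hr : 0 < r) (hw : ∀ k, 0 < w k)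
    (hsum : HasSum w 1) (hrec : ∀ k : ℕ, (k + 1 : ℝ) * w (k + 1) = r * w k) (h0 : 1 - w 0 ≤ r)
    (A : Set ℕ) {a : ℝ} (ha : HasSum (A.indicator w) a) :
    ∃ f : ℕ → ℝ, (∀ k : ℕ, r * f (k + 1) - k * f k = A.indicator 1 k - a) ∧
      ∀ k : ℕ, 1 ≤ k → |f (k + 1) - f k| ≤ 1 := by
  have hind : ∀ k, A.indicator w k = A.indicator 1 k * w k := by
    intro k; by_cases hk : k ∈ A <;> simp [hk]
  have hind0 : ∀ k, 0 ≤ A.indicator w k := fun k => Set.indicator_nonneg (fun _ _ => (hw _).le) k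
  have hindle : ∀ k, A.indicator w k ≤ w k :=
    fun k => Set.indicator_le_self' (fun _ _ => (hw _).le) k
  set α : ℕ → ℝ := fun k => ∑ j ∈ Finset.range k, A.indicator w j with hα
  set S : ℕ → ℝ := fun k => ∑ j ∈ Finset.range k, w j with hS
  have hαs : ∀ k, α (k + 1) = α k + A.indicator w k := fun k => Finset.sum_range_succ ..
  have hSs : ∀ k, S (k + 1) = S k + w k := fun k => Finset.sum_range_succ ..
  have hstep : ∀ k : ℕ, r * ((α (k + 1) - a * S (k + 1)) / ((k + 1 : ℕ) * w (k + 1))) =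
      (α (k + 1) - a * S (k + 1)) / w k := by
    intro k
    push_cast
    rw [hrec]
    have := (hw k).ne'
    field_simp
  -- Solution of the recursion by summation. The value at `k = 0` is the default `0 / 0 = 0`,
  -- harmless because it is multiplied by `k`.
  refine ⟨fun k => (α k - a * S k) / (k * w k), ?_, ?_⟩
  · intro k
    simp only
    rw [hstep]
    have hwk := (hw k).ne'
    have h2 : (k : ℝ) * ((α k - a * S k) / (k * w k)) = (α k - a * S k) / w k := by
      rcases Nat.eq_zero_or_pos k with rfl | hk
      · simp [hα, hS]
      · have : (k : ℝ) ≠ 0 := by positivity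
        field_simp
    rw [h2, hαs, hSs, hind]
    field_simp
    ring
  · intro k hk
    have hk0 : (0 : ℝ) < k := by exact_mod_cast hk
    have hwk := hw k
    set R : ℝ := ∑' i, w (i + (k + 1)) with hR
    set β : ℝ := ∑' i, A.indicator w (i + (k + 1)) with hβ
    have hws := hsum.summable
    have has := ha.summable
    have hRs : Summable fun i => w (i + (k + 1)) := (summable_nat_add_iff (k + 1)).2 hws
    have hβs : Summable fun i => A.indicator w (i + (k + 1)) := (summable_nat_add_iff (k + 1)).2 has
    have e1 : S k + w k + R = 1 := by
      rw [← hSs, ← hsum.tsum_eq]; exact hws.sum_add_tsum_nat_add (k + 1)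
    have e2 : α k + A.indicator w k + β = a := by
      rw [← hαs, ← ha.tsum_eq]; exact has.sum_add_tsum_nat_add (k + 1)
    have hβ0 : 0 ≤ β := tsum_nonneg fun i => hind0 _
    have hβR : β ≤ R := hβs.tsum_le_tsum (fun i => hindle _) hRs
    have hα0 : 0 ≤ α k := Finset.sum_nonneg fun _ _ => hind0 _
    have hαS : α k ≤ S k := Finset.sum_le_sum fun _ _ => hindle _
    -- Termwise, `k * w (i + k + 1) ≤ (i + k + 1) * w (i + k + 1) = r * w (i + k)`.
    have i1 : k * R ≤ r * (R + w k) := by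
      have e3 : R + w k = ∑' i, w (i + k) := by
        rw [((summable_nat_add_iff k).2 hws).tsum_eq_zero_add, hR, zero_add, add_comm]
        congr 2
        funext i
        congr 1
        omega
      rw [e3, hR, ← tsum_mul_left, ← tsum_mul_left]
      refine (hRs.mul_left _).tsum_le_tsum (fun i => ?_) (((summable_nat_add_iff k).2 hws).mul_left _)
      rw [← hrec, ← add_assoc]
      refine mul_le_mul_of_nonneg_right ?_ (hw _).le
      push_cast
      have : (0 : ℝ) ≤ i := Nat.cast_nonneg i
      linarith
    have i2 : ∀ n : ℕ, n ≤ k → r * S n ≤ k * (S (n + 1) - w 0) := by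
      intro n
      induction n with
      | zero => intro _; simp [hS]
      | succ n ih =>
        intro hn
        have := ih (by omega)
        rw [hSs (n + 1), hSs n] at *
        have h3 : (n + 1 : ℝ) * w (n + 1) ≤ k * w (n + 1) :=
          mul_le_mul_of_nonneg_right (by exact_mod_cast hn) (hw _).le
        have := hrec n
        nlinarith
    have i2k := i2 k le_rfl
    rw [hSs] at i2k
    -- By `i2k` the left side is at most `k * (1 - w 0)`, and `1 - w 0 ≤ r`.
    have i3 : k * R + r * S k ≤ r * k := by nlinarith
    have i4 : 0 ≤ k * (S k + w k) - r * S k := by nlinarith [hw 0]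
    set c := A.indicator w k with hc
    have hc0 : 0 ≤ c := hind0 k
    have hcw : c ≤ w k := hindle k
    have hSk : 0 ≤ S k := hα0.trans hαS
    have hR0 : 0 ≤ R := hβ0.trans hβR
    -- The increment is split by the mass of `A` below `k` (`α k`), at `k` (`c`) and above `k`
    -- (`β`). Only the middle term is nonnegative, which gives the upper bound. With the full masses
    -- `S k`, `w k`, `R` the three terms cancel, so the outer two are together at least `-w k * (k *
    -- R + r * S k)`, which gives the lower bound.
    have hD : (α (k + 1) - a * S (k + 1)) / ((k + 1 : ℕ) * w (k + 1)) -
        (α k - a * S k) / (k * w k) =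
        (α k * (k * R - r * (R + w k)) + c * (k * R + r * S k) -
          β * (k * (S k + w k) - r * S k)) / (r * k * w k) := by
      have := hstep k
      have h5 : (α (k + 1) - a * S (k + 1)) / ((k + 1 : ℕ) * w (k + 1)) =
          (α (k + 1) - a * S (k + 1)) / (r * w k) := by
        push_cast; rw [hrec]
      rw [h5, hαs, hSs, ← hc, ← e2]
      have hR' : R = 1 - S k - w k := by linarith
      rw [hR']
      field_simp
      ring
    rw [hD, abs_le, le_div_iff₀ (by positivity), div_le_iff₀ (by positivity)]
    have j1 : α k * (k * R - r * (R + w k)) ≤ 0 :=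
      mul_nonpos_of_nonneg_of_nonpos hα0 (by linarith)
    have j2 : S k * (k * R - r * (R + w k)) ≤ α k * (k * R - r * (R + w k)) :=
      mul_le_mul_of_nonpos_right hαS (by linarith)
    have j3 : 0 ≤ β * (k * (S k + w k) - r * S k) := mul_nonneg hβ0 i4
    have j4 : β * (k * (S k + w k) - r * S k) ≤ R * (k * (S k + w k) - r * S k) :=
      mul_le_mul_of_nonneg_right hβR i4
    have j5 : 0 ≤ c * (k * R + r * S k) := by positivity
    have j6 : c * (k * R + r * S k) ≤ w k * (r * k) :=
      (mul_le_mul_of_nonneg_right hcw (by positivity)).trans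
        (mul_le_mul_of_nonneg_left i3 hwk.le)
    have j7 : w k * (k * R + r * S k) ≤ w k * (r * k) := mul_le_mul_of_nonneg_left i3 hwk.le
    constructor <;> linarith

theorem exists_stein_solution_poisson {r : ℝ≥0} (hr : 0 < r) (A : Set ℕ) :
    ∃ f : ℕ → ℝ, (∀ k : ℕ, (r : ℝ) * f (k + 1) - k * f k =
        A.indicator 1 k - (poissonMeasure r).real A) ∧
      ∀ k : ℕ, 1 ≤ k → |f (k + 1) - f k| ≤ 1 := by
  have hs := hasSum_indicator_real_singleton (poissonMeasure r) Set.univ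
  simp only [Set.indicator_univ, probReal_univ] at hs
  refine exists_stein_solution (w := fun k => (poissonMeasure r).real {k}) (by exact_mod_cast hr)
    (fun k => poissonMeasure_real_singleton_pos k hr) hs (fun k => ?_) ?_ A
    (hasSum_indicator_real_singleton _ A)
  · simp only [poissonMeasure_real_singleton, Nat.factorial_succ]
    have : (k + 1 : ℝ) ≠ 0 := by positivity
    have : (k.factorial : ℝ) ≠ 0 := by positivity
    push_cast
    field_simp
    ring
  · simp only [poissonMeasure_real_singleton]
    have := Real.add_one_le_exp (-(r : ℝ))
    simp
    linarith

theorem abs_sub_le_of_increments {f : ℕ → ℝ} (hf : ∀ k : ℕ, 1 ≤ k → |f (k + 1) - f k| ≤ 1)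
    (a t : ℕ) : |f (a + t + 1) - f (a + 1)| ≤ t := by
  induction t with
  | zero => simp
  | succ t ih =>
    have h := hf (a + t + 1) (by omega)
    have e : f (a + (t + 1) + 1) - f (a + 1) =
        (f (a + t + 1 + 1) - f (a + t + 1)) + (f (a + t + 1) - f (a + 1)) := by
      rw [← add_assoc a t 1]; ring
    rw [e]
    refine (abs_add_le _ _).trans ?_
    push_cast
    linarith

/-- The Stein-Chen estimate for a sum of indicators with neighbourhoods of dependence `B`, on a
finite probability space with weights `w`. -/
theorem stein_chen_le {S ι : Type*} [Fintype S] [Fintype ι] [DecidableEq ι] {w : S → ℝ}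
    (hw : ∀ x, 0 ≤ w x) (X : ι → S → ℕ) (hX : ∀ i x, X i x = 0 ∨ X i x = 1)
    (B : ι → Finset ι) (hB : ∀ i, i ∈ B i) (p : ι → ℝ) (hp : ∀ i, ∑ x, w x * X i x = p i)
    (hind : ∀ i (g : ℕ → ℝ), ∑ x, w x * (X i x * g (∑ j ∈ (B i)ᶜ, X j x)) =
      p i * ∑ x, w x * g (∑ j ∈ (B i)ᶜ, X j x))
    {f : ℕ → ℝ} (hf : ∀ k : ℕ, 1 ≤ k → |f (k + 1) - f k| ≤ 1) :
    ∑ x, w x * ((∑ i, p i) * f ((∑ i, X i x) + 1) -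
        ((∑ i, X i x : ℕ) : ℝ) * f (∑ i, X i x)) ≤
      ∑ i, ∑ j ∈ B i, p i * p j + ∑ i, ∑ j ∈ (B i).erase i, ∑ x, w x * (X i x * X j x) := by
  have hp0 : ∀ i, 0 ≤ p i := fun i => by
    rw [← hp]; exact Finset.sum_nonneg fun x _ => mul_nonneg (hw x) (Nat.cast_nonneg _)
  have hW : ∀ i x, ∑ j, X j x = ∑ j ∈ (B i)ᶜ, X j x + ∑ j ∈ B i, X j x := fun i x =>
    (Finset.sum_compl_add_sum _ _).symm
  have hWe : ∀ i x, ∑ j ∈ B i, X j x = X i x + ∑ j ∈ (B i).erase i, X j x := fun i x =>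
    (Finset.add_sum_erase _ _ (hB i)).symm
  have hi : ∀ i, p i * ∑ x, w x * f ((∑ i, X i x) + 1) - ∑ x, w x * (X i x * f (∑ i, X i x)) ≤
      ∑ j ∈ B i, p i * p j + ∑ j ∈ (B i).erase i, ∑ x, w x * (X i x * X j x) := by
    intro i
    -- Dropping the indicators in `B i` from the sum costs at most their number. Every argument of
    -- `f` compared here and in `h2` is at least 1, because of the `+ 1` or because `X i x = 1`, so
    -- increments away from zero suffice. Independence (`hind`) links the two comparisons.
    have h1 : ∑ x, w x * f ((∑ i, X i x) + 1) - ∑ x, w x * f ((∑ j ∈ (B i)ᶜ, X j x) + 1) ≤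
        ∑ j ∈ B i, p j := by
      simp_rw [← hp]
      rw [Finset.sum_comm, ← Finset.sum_sub_distrib]
      refine Finset.sum_le_sum fun x _ => ?_
      rw [← mul_sub, ← Finset.mul_sum]
      refine mul_le_mul_of_nonneg_left ?_ (hw x)
      have := (le_abs_self _).trans
        (abs_sub_le_of_increments hf (∑ j ∈ (B i)ᶜ, X j x) (∑ j ∈ B i, X j x))
      rw [hW i x]
      push_cast at this ⊢
      exact this
    have h2 : ∑ x, w x * (X i x * f ((∑ j ∈ (B i)ᶜ, X j x) + 1)) -
        ∑ x, w x * (X i x * f (∑ i, X i x)) ≤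
        ∑ j ∈ (B i).erase i, ∑ x, w x * (X i x * X j x) := by
      rw [Finset.sum_comm, ← Finset.sum_sub_distrib]
      refine Finset.sum_le_sum fun x _ => ?_
      rw [← mul_sub, ← Finset.mul_sum]
      refine mul_le_mul_of_nonneg_left ?_ (hw x)
      rcases hX i x with h | h
      · simp [h]
      · have := (neg_le_abs _).trans
          (abs_sub_le_of_increments hf (∑ j ∈ (B i)ᶜ, X j x) (∑ j ∈ (B i).erase i, X j x))
        rw [hW i x, hWe, h, add_comm 1, ← add_assoc]
        push_cast at this ⊢
        simp only [one_mul]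
        linarith
    have h3 := hind i fun k => f (k + 1)
    have h4 := mul_le_mul_of_nonneg_left h1 (hp0 i)
    rw [mul_sub, Finset.mul_sum (B i)] at h4
    linarith
  calc _ = ∑ i, (p i * ∑ x, w x * f ((∑ i, X i x) + 1) -
        ∑ x, w x * (X i x * f (∑ i, X i x))) := by
        rw [Finset.sum_sub_distrib, ← Finset.sum_mul, Finset.sum_comm (s := Finset.univ (α := ι)),
          Finset.mul_sum, ← Finset.sum_sub_distrib]
        refine Finset.sum_congr rfl fun x _ => ?_
        rw [← Finset.mul_sum, ← Finset.sum_mul]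
        push_cast
        ring
    _ ≤ _ := by
        rw [← Finset.sum_add_distrib]
        exact Finset.sum_le_sum fun i _ => hi i

/-! ### Stein–Chen for increasing blocks under the Mallows law. -/

/-- The probability of `σ` under the Mallows distribution. -/
def mallowsWeight {n : ℕ} (q : ℝ) (σ : Equiv.Perm (Fin n)) : ℝ := q ^ numInv σ / invPoly n q

theorem mallowsWeight_nonneg {n : ℕ} {q : ℝ} (hq : 0 < q) (σ : Equiv.Perm (Fin n)) :
    0 ≤ mallowsWeight q σ := div_nonneg (by positivity) (invPoly_pos n hq).le

theorem sum_mallowsWeight (n : ℕ) {q : ℝ} (hq : 0 < q) :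
    ∑ σ : Equiv.Perm (Fin n), mallowsWeight q σ = 1 := by
  simp_rw [mallowsWeight]
  rw [← Finset.sum_div, sum_pow_numInv, div_self (invPoly_pos n hq).ne']

open Classical in
theorem sum_mallowsWeight_incOn_mul {n m s : ℕ} (h : s + m ≤ n) {q : ℝ} (hq : 0 < q)
    (F : Equiv.Perm (Fin n) → ℝ) (hF : ∀ σ τ, F (σ * blockPerm h τ) = F σ) :
    ∑ σ, mallowsWeight q σ * ((if IncOn s m σ then 1 else 0) * F σ) =
      1 / invPoly m q * ∑ σ, mallowsWeight q σ * F σ := by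
  have hm := (invPoly_pos m hq).ne'
  simp_rw [mallowsWeight, div_mul_eq_mul_div]
  rw [← Finset.sum_div, ← Finset.sum_div, sum_pow_numInv_mul h q F hF]
  field_simp

open Classical in
theorem sum_mallowsWeight_incOn {n m s : ℕ} (h : s + m ≤ n) {q : ℝ} (hq : 0 < q) :
    ∑ σ : Equiv.Perm (Fin n), mallowsWeight q σ * (if IncOn s m σ then 1 else 0) =
      1 / invPoly m q := by
  have := sum_mallowsWeight_incOn_mul h hq (fun _ => 1) (fun _ _ => rfl)
  simpa [sum_mallowsWeight n hq] using this

theorem sum_mallowsWeight_occ {n m : ℕ} {q : ℝ} (hq : 0 < q) (i : Fin (n + 1 - m)) :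
    ∑ σ : Equiv.Perm (Fin n), mallowsWeight q σ * (occ (incPattern m) σ i : ℕ) =
      1 / invPoly m q := by
  classical
  rw [← sum_mallowsWeight_incOn (n := n) (m := m) (s := i) (by omega) hq]
  simp [occ_incPattern]

theorem sum_mallowsWeight_occ_mul_occ {n m : ℕ} {q : ℝ} (hq : 0 < q) {i j : Fin (n + 1 - m)}
    (hij : i < j) (hjm : (j : ℕ) - i < m) :
    ∑ σ : Equiv.Perm (Fin n), mallowsWeight q σ *
      ((occ (incPattern m) σ i : ℕ) * (occ (incPattern m) σ j : ℕ)) =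
      1 / invPoly (m + (j - i)) q := by
  classical
  have hij' := Fin.lt_def.1 hij
  rw [← sum_mallowsWeight_incOn (n := n) (m := m + (j - i)) (s := i) (by omega) hq]
  refine Finset.sum_congr rfl fun σ _ => ?_
  have h := incOn_and_incOn_iff (s := i) hjm σ
  rw [show (i : ℕ) + (j - i) = j by omega] at h
  rw [occ_incPattern, occ_incPattern, ← if_congr h rfl rfl]
  by_cases h1 : IncOn i m σ <;> by_cases h2 : IncOn j m σ <;> simp [h1, h2]

/-- The blocks that overlap the block starting at `i`. -/
def overlap {N : ℕ} (m : ℕ) (i : Fin N) : Finset (Fin N) :=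
  Finset.univ.filter fun j => (j : ℕ) < i + m ∧ (i : ℕ) < j + m

theorem sum_mallowsWeight_occ_mul {n m : ℕ} {q : ℝ} (hq : 0 < q) (i : Fin (n + 1 - m))
    (g : ℕ → ℝ) :
    ∑ σ : Equiv.Perm (Fin n), mallowsWeight q σ * ((occ (incPattern m) σ i : ℕ) *
        g (∑ j ∈ (overlap m i)ᶜ, occ (incPattern m) σ j)) =
      1 / invPoly m q * ∑ σ : Equiv.Perm (Fin n), mallowsWeight q σ *
        g (∑ j ∈ (overlap m i)ᶜ, occ (incPattern m) σ j) := by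
  classical
  have h : (i : ℕ) + m ≤ n := by omega
  rw [← sum_mallowsWeight_incOn_mul h hq]
  · simp [occ_incPattern]
  · intro σ τ
    congr 1
    refine Finset.sum_congr rfl fun j hj => ?_
    have hj' : (i : ℕ) + m ≤ j ∨ (j : ℕ) + m ≤ i := by
      simp only [overlap, Finset.mem_compl, Finset.mem_filter, Finset.mem_univ, true_and] at hj
      omega
    rw [occ_incPattern, occ_incPattern, incOn_mul_blockPerm_iff h hj']

theorem mallows_stein_chen {n m : ℕ} (hm : 1 ≤ m) {q : ℝ} (hq : 0 < q) {r : ℝ≥0} (hr : 0 < r)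
    (hrm : (r : ℝ) = ((n + 1 - m : ℕ) : ℝ) * (1 / invPoly m q)) (A : Set ℕ) :
    ∑ σ : Equiv.Perm (Fin n), mallowsWeight q σ * A.indicator 1 (numOcc (incPattern m) σ) -
        (poissonMeasure r).real A ≤
      ∑ i : Fin (n + 1 - m), ∑ _j ∈ overlap m i, 1 / invPoly m q * (1 / invPoly m q) +
      ∑ i : Fin (n + 1 - m), ∑ j ∈ (overlap m i).erase i,
        ∑ σ : Equiv.Perm (Fin n), mallowsWeight q σ *
          ((occ (incPattern m) σ i : ℕ) * (occ (incPattern m) σ j : ℕ)) := by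
  obtain ⟨f, hf, hf1⟩ := exists_stein_solution_poisson hr A
  have h := stein_chen_le (w := mallowsWeight q) (fun σ => mallowsWeight_nonneg hq σ)
    (fun (i : Fin (n + 1 - m)) σ => occ (incPattern m) σ i)
    (fun i σ => by unfold occ; split_ifs <;> simp)
    (overlap m) (fun i => by simp [overlap]; omega) (fun _ => 1 / invPoly m q)
    (fun i => sum_mallowsWeight_occ hq i) (fun i g => sum_mallowsWeight_occ_mul hq i g) hf1
  refine le_of_eq_of_le ?_ h
  have hs : ∑ i : Fin (n + 1 - m), 1 / invPoly m q = (r : ℝ) := by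
    rw [hrm]; simp
  rw [hs]
  have : ∀ σ : Equiv.Perm (Fin n), ∑ i, occ (incPattern m) σ i = numOcc (incPattern m) σ :=
    fun _ => rfl
  simp_rw [this, hf, mul_sub]
  rw [Finset.sum_sub_distrib, ← Finset.sum_mul, sum_mallowsWeight n hq, one_mul]

/-! ### Counting pairs of overlapping blocks by distance. -/

theorem sum_range_window (N m i : ℕ) (G : ℕ → ℝ) :
    ∑ j ∈ Finset.range N, (if i < j ∧ j < i + m then G (j - i) else 0) =
      ∑ e ∈ Finset.range (m - 1), if i + e + 1 < N then G (e + 1) else 0 := by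
  rw [← Finset.sum_filter, ← Finset.sum_filter]
  refine Finset.sum_nbij' (fun j => j - i - 1) (fun e => i + e + 1) ?_ ?_ ?_ ?_ ?_
  · intro j hj
    simp only [Finset.mem_filter, Finset.mem_range] at hj ⊢
    omega
  · intro e he
    simp only [Finset.mem_filter, Finset.mem_range] at he ⊢
    omega
  · intro j hj
    simp only [Finset.mem_filter, Finset.mem_range] at hj
    omega
  · intro e he
    omega
  · intro j hj
    simp only [Finset.mem_filter, Finset.mem_range] at hj
    congr 1
    omega

theorem sum_sum_range_window (N m : ℕ) (G : ℕ → ℝ) :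
    ∑ i ∈ Finset.range N, ∑ j ∈ Finset.range N,
        (if i < j ∧ j < i + m then G (j - i) else 0) =
      ∑ e ∈ Finset.range (m - 1), ((N - (e + 1) : ℕ) : ℝ) * G (e + 1) := by
  simp_rw [sum_range_window]
  rw [Finset.sum_comm]
  refine Finset.sum_congr rfl fun e _ => ?_
  rw [← Finset.sum_filter, Finset.sum_const, nsmul_eq_mul]
  congr 2
  have : (Finset.range N).filter (fun i => i + e + 1 < N) = Finset.range (N - (e + 1)) := by
    ext i
    simp only [Finset.mem_filter, Finset.mem_range]
    omega
  rw [this, Finset.card_range]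

/-- By symmetry each unordered pair counts twice, and `N - d` pairs lie at distance `d`; the
truncated subtraction gives zero when `d ≥ N`. -/
theorem sum_overlap_erase {N m : ℕ} (F : Fin N → Fin N → ℝ) (hF : ∀ i j, F i j = F j i)
    (G : ℕ → ℝ) (hG : ∀ i j : Fin N, i < j → (j : ℕ) - i < m → F i j = G (j - i)) :
    ∑ i, ∑ j ∈ (overlap m i).erase i, F i j =
      2 * ∑ e ∈ Finset.range (m - 1), ((N - (e + 1) : ℕ) : ℝ) * G (e + 1) := by
  have h1 : ∀ i, ∑ j ∈ (overlap m i).erase i, F i j =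
      ∑ j : Fin N, (if (i : ℕ) < j ∧ (j : ℕ) < i + m then F i j else 0) +
      ∑ j : Fin N, (if (j : ℕ) < i ∧ (i : ℕ) < j + m then F j i else 0) := by
    intro i
    have : (overlap m i).erase i = Finset.univ.filter fun j : Fin N =>
        j ≠ i ∧ (j : ℕ) < i + m ∧ (i : ℕ) < j + m := by
      ext j; simp [overlap]
    rw [this, Finset.sum_filter, ← Finset.sum_add_distrib]
    refine Finset.sum_congr rfl fun j _ => ?_
    rw [hF j i]
    rcases lt_trichotomy (i : ℕ) j with h | h | h
    · rw [if_neg (c := (j : ℕ) < i ∧ (i : ℕ) < j + m) (by omega), add_zero]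
      exact if_congr (by rw [Ne, Fin.ext_iff]; omega) rfl rfl
    · rw [if_neg (by rw [Ne, Fin.ext_iff]; omega), if_neg (by omega), if_neg (by omega), add_zero]
    · rw [if_neg (c := (i : ℕ) < j ∧ (j : ℕ) < i + m) (by omega), zero_add]
      exact if_congr (by rw [Ne, Fin.ext_iff]; omega) rfl rfl
  simp_rw [h1]
  rw [Finset.sum_add_distrib, Finset.sum_comm (f := fun i j : Fin N =>
    if (j : ℕ) < i ∧ (i : ℕ) < j + m then F j i else 0), ← two_mul, ← sum_sum_range_window,
    ← Fin.sum_univ_eq_sum_range (fun i => ∑ j ∈ Finset.range N,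
      (if i < j ∧ j < i + m then G (j - i) else 0))]
  congr 1
  refine Finset.sum_congr rfl fun i _ => ?_
  rw [← Fin.sum_univ_eq_sum_range (fun j => if (i : ℕ) < j ∧ j < i + m then G (j - i) else 0)]
  refine Finset.sum_congr rfl fun j _ => ?_
  split_ifs with h
  · exact hG i j h.1 (by omega)
  · rfl

theorem mallows_sub_poisson_le {n m : ℕ} (hm : 1 ≤ m) {q : ℝ} (hq : 0 < q) {r : ℝ≥0}
    (hr : 0 < r) (hrm : (r : ℝ) = ((n + 1 - m : ℕ) : ℝ) * (1 / invPoly m q)) (A : Set ℕ) :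
    ∑ σ : Equiv.Perm (Fin n), mallowsWeight q σ * A.indicator 1 (numOcc (incPattern m) σ) -
        (poissonMeasure r).real A ≤
      ((n + 1 - m : ℕ) : ℝ) * (1 / invPoly m q) ^ 2 +
        2 * ∑ e ∈ Finset.range (m - 1), ((n + 1 - m - (e + 1) : ℕ) : ℝ) *
          ((1 / invPoly m q) ^ 2 + 1 / invPoly (m + (e + 1)) q) := by
  refine (mallows_stein_chen hm hq hr hrm A).trans (le_of_eq ?_)
  rw [sum_overlap_erase (fun i j => ∑ σ : Equiv.Perm (Fin n), mallowsWeight q σ *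
      ((occ (incPattern m) σ i : ℕ) * (occ (incPattern m) σ j : ℕ)))
    (fun i j => by simp_rw [mul_comm ((occ (incPattern m) _ i : ℕ) : ℝ)])
    (fun d => 1 / invPoly (m + d) q) (fun i j hij hjm => sum_mallowsWeight_occ_mul_occ hq hij hjm)]
  have h := sum_overlap_erase (N := n + 1 - m) (m := m)
    (fun _ _ => 1 / invPoly m q * (1 / invPoly m q)) (fun _ _ => rfl)
    (fun _ => 1 / invPoly m q * (1 / invPoly m q)) (fun _ _ _ _ => rfl)
  have h1 : ∀ i : Fin (n + 1 - m), ∑ _j ∈ overlap m i, 1 / invPoly m q * (1 / invPoly m q) =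
      1 / invPoly m q * (1 / invPoly m q) +
        ∑ _j ∈ (overlap m i).erase i, 1 / invPoly m q * (1 / invPoly m q) := fun i =>
    (Finset.add_sum_erase _ _ (by simp [overlap]; omega)).symm
  simp_rw [h1]
  rw [Finset.sum_add_distrib, h]
  simp only [mul_add, Finset.sum_add_distrib, Finset.sum_const, Finset.card_univ, Fintype.card_fin,
    nsmul_eq_mul, sq]
  ring

/-! ### Growth of the inversion polynomials. -/

theorem geom_sum_add_le {q : ℝ} (hq : 0 < q) (a b : ℕ) :
    ∑ i ∈ Finset.range (a + 1 + b), q ^ i ≤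
      (∑ i ∈ Finset.range (a + 1), q ^ i) * ∑ i ∈ Finset.range (b + 1), q ^ i := by
  induction b with
  | zero => simp
  | succ b ih =>
    rw [← add_assoc, Finset.sum_range_succ _ (a + 1 + b), Finset.sum_range_succ _ (b + 1), mul_add]
    refine add_le_add ih ?_
    have : q ^ a ≤ ∑ i ∈ Finset.range (a + 1), q ^ i :=
      Finset.single_le_sum (f := fun i => q ^ i) (fun i _ => by positivity) (by simp)
    rw [show a + 1 + b = a + (b + 1) by omega, pow_add]
    exact mul_le_mul_of_nonneg_right this (by positivity)

theorem invPoly_add (k d : ℕ) (q : ℝ) :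
    invPoly (k + d) q =
      invPoly k q * ∏ i ∈ Finset.range d, ∑ j ∈ Finset.range (k + i + 1), q ^ j := by
  induction d with
  | zero => simp
  | succ d ih =>
    rw [Finset.prod_range_succ, ← mul_assoc, ← ih, ← add_assoc, invPoly, invPoly,
      Finset.prod_Icc_succ_top (by omega)]

theorem one_le_geom_sum {q : ℝ} (hq : 0 < q) (k : ℕ) :
    1 ≤ ∑ i ∈ Finset.range (k + 1), q ^ i := by
  have := Finset.single_le_sum (f := fun i => q ^ i) (s := Finset.range (k + 1))
    (fun i _ => by positivity) (a := 0) (by simp)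
  simpa using this

theorem invPoly_le_add {q : ℝ} (hq : 0 < q) (k d : ℕ) : invPoly k q ≤ invPoly (k + d) q := by
  rw [invPoly_add]
  exact le_mul_of_one_le_right (invPoly_pos k hq).le
    (Finset.one_le_prod fun i _ => one_le_geom_sum hq _)

/-- Writing `[k]` for the geometric sum of length `k`, it suffices that `∏_{i<d} [m+i+1] ≤ I_m`. By
`geom_sum_add_le`, `[m+i+1] ≤ [m-d+i+1] [d+i+1]`. The first factors are the last `d` factors of
`I_m`; the second ones multiply to at most `I_{2d} ≤ I_{m-d}`, as `2 d ≤ m - d`. -/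
theorem invPoly_add_le_sq {q : ℝ} (hq : 0 < q) {m d : ℕ} (h : 3 * d ≤ m) :
    invPoly (m + d) q ≤ invPoly m q ^ 2 := by
  obtain ⟨k, rfl⟩ : ∃ k, m = 2 * d + k + d := ⟨m - 3 * d, by omega⟩
  have h1 : ∏ i ∈ Finset.range d, ∑ j ∈ Finset.range (2 * d + k + d + i + 1), q ^ j ≤
      (∏ i ∈ Finset.range d, ∑ j ∈ Finset.range (2 * d + k + i + 1), q ^ j) *
        ∏ i ∈ Finset.range d, ∑ j ∈ Finset.range (d + i + 1), q ^ j := by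
    rw [← Finset.prod_mul_distrib]
    refine Finset.prod_le_prod (fun i _ => Finset.sum_nonneg fun _ _ => by positivity) fun i _ => ?_
    refine le_trans ?_ (geom_sum_add_le hq _ _)
    exact Finset.sum_le_sum_of_subset_of_nonneg (Finset.range_subset_range.2 (by omega))
      fun _ _ _ => by positivity
  have h2 : ∏ i ∈ Finset.range d, ∑ j ∈ Finset.range (d + i + 1), q ^ j ≤
      invPoly (2 * d + k) q := by
    refine le_trans ?_ (invPoly_le_add hq (2 * d) k)
    rw [two_mul, invPoly_add]
    refine le_mul_of_one_le_left (Finset.prod_nonneg fun i _ =>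
      Finset.sum_nonneg fun _ _ => by positivity) ?_
    simpa [invPoly] using invPoly_le_add hq 0 d
  have h3 : ∏ i ∈ Finset.range d, ∑ j ∈ Finset.range (2 * d + k + d + i + 1), q ^ j ≤
      invPoly (2 * d + k + d) q := by
    refine h1.trans ?_
    rw [invPoly_add (2 * d + k) d, mul_comm (invPoly _ _)]
    exact mul_le_mul_of_nonneg_left h2 (Finset.prod_nonneg fun i _ =>
      Finset.sum_nonneg fun _ _ => by positivity)
  rw [invPoly_add (2 * d + k + d) d, sq]
  exact mul_le_mul_of_nonneg_left h3 (invPoly_pos _ hq).le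

/-! ### Comparison with the stated error bound. -/

theorem two_mul_sum_range_sub {N k : ℕ} (h : k ≤ N) :
    2 * ∑ e ∈ Finset.range k, ((N - (e + 1) : ℕ) : ℝ) = k * (2 * N - 1 - k) := by
  induction k with
  | zero => simp
  | succ k ih =>
    rw [Finset.sum_range_succ, mul_add, ih (by omega), Nat.cast_sub h]
    push_cast
    ring

/-- Comparison of the two error bounds when there are at least `m` blocks. -/
theorem error_le_of_le {N m : ℕ} (hm : 2 ≤ m) (hN : m ≤ N) (h22 : ¬ (m = 2 ∧ N = 2)) {p : ℝ}
    {J : ℕ → ℝ} (hJ : ∀ e, 0 ≤ J e) :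
    N * p ^ 2 + 2 * ∑ e ∈ Finset.range (m - 1), ((N - (e + 1) : ℕ) : ℝ) * (p ^ 2 + J e) ≤
      2 * (m * (2 * N - m - 1) * p ^ 2 +
        (m - 1) * (2 * N - m - 2) * ∑ e ∈ Finset.range (m - 1), J e) := by
  have hs := two_mul_sum_range_sub (N := N) (k := m - 1) (by omega)
  have hm' : (2 : ℝ) ≤ m := by exact_mod_cast hm
  have hN' : (m : ℝ) ≤ N := by exact_mod_cast hN
  rw [Nat.cast_sub (by omega)] at hs
  push_cast at hs
  -- Fails only for `m = N = 2`, where the right side is zero.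
  have h1 : (N - 1 : ℝ) ≤ (m - 1) * (2 * N - m - 2) := by
    by_cases h : m = 2
    · subst h
      have : (3 : ℝ) ≤ N := by exact_mod_cast (by omega : 3 ≤ N)
      push_cast
      linarith
    · have : (3 : ℝ) ≤ m := by exact_mod_cast (by omega : 3 ≤ m)
      nlinarith
  have h2 : ∑ e ∈ Finset.range (m - 1), ((N - (e + 1) : ℕ) : ℝ) * J e ≤
      (m - 1) * (2 * N - m - 2) * ∑ e ∈ Finset.range (m - 1), J e := by
    rw [Finset.mul_sum]
    refine Finset.sum_le_sum fun e he => mul_le_mul_of_nonneg_right (le_trans ?_ h1) (hJ e)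
    have := Finset.mem_range.1 he
    rw [Nat.cast_sub (by omega)]
    push_cast
    have : (0 : ℝ) ≤ e := Nat.cast_nonneg e
    linarith
  have h3 : (N + 2 * ∑ e ∈ Finset.range (m - 1), ((N - (e + 1) : ℕ) : ℝ)) * p ^ 2 ≤
      2 * (m * (2 * N - m - 1)) * p ^ 2 := by
    refine mul_le_mul_of_nonneg_right ?_ (sq_nonneg p)
    rw [hs]
    nlinarith
  simp only [mul_add, Finset.sum_add_distrib]
  rw [← Finset.sum_mul]
  linarith

/-- Comparison of the two error bounds when any two blocks overlap. -/
theorem error_le_of_lt {N m : ℕ} (hN : N < m) (hm : m + 3 ≤ 2 * N) {p : ℝ}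
    {J : ℕ → ℝ} (hJ : ∀ e, 0 ≤ J e) (hJp : ∀ e, 3 * (e + 1) ≤ m → p ^ 2 ≤ J e) :
    N * p ^ 2 + 2 * ∑ e ∈ Finset.range (m - 1), ((N - (e + 1) : ℕ) : ℝ) * (p ^ 2 + J e) ≤
      2 * (m * (2 * N - m - 1) * p ^ 2 +
        (m - 1) * (2 * N - m - 2) * ∑ e ∈ Finset.range (m - 1), J e) := by
  have hNm' : (N + 1 : ℝ) ≤ m := by exact_mod_cast hN
  have hm' : (m + 3 : ℝ) ≤ 2 * N := by exact_mod_cast hm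
  have hN0 : (0 : ℝ) ≤ N := Nat.cast_nonneg N
  -- All pairs of blocks overlap: the terms with `e ≥ N` are truncated to zero.
  have hs : 2 * ∑ e ∈ Finset.range (m - 1), ((N - (e + 1) : ℕ) : ℝ) = N * (N - 1) := by
    rw [← Finset.sum_subset (Finset.range_subset_range.2 (by omega : N ≤ m - 1)),
      two_mul_sum_range_sub le_rfl]
    · ring
    · intro e _ he
      have := Finset.mem_range.not.1 he
      rw [Nat.sub_eq_zero_of_le (by omega), Nat.cast_zero]
  set D := m / 3 with hD
  have hDs := two_mul_sum_range_sub (N := N) (k := D) (by omega)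
  have hD1 : (m - 2 : ℝ) ≤ 3 * D := by
    have : m ≤ 3 * D + 2 := by omega
    have : (m : ℝ) ≤ 3 * D + 2 := by exact_mod_cast this
    linarith
  set n₂ : ℝ := (m - 1) * (2 * N - m - 2) with hn₂
  have hn₂N : (N : ℝ) ≤ n₂ := by rw [hn₂]; nlinarith
  have hterm : ∀ e, 0 ≤ n₂ - ((N - (e + 1) : ℕ) : ℝ) := by
    intro e
    have : ((N - (e + 1) : ℕ) : ℝ) ≤ N := by exact_mod_cast Nat.sub_le _ _
    linarith
  -- The surplus of the coefficient `n₂` over the needed one is traded for multiples of `p ^ 2`, for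
  -- the `D` indices where `p ^ 2 ≤ J e`.
  have h1 : ∑ e ∈ Finset.range D, (n₂ - ((N - (e + 1) : ℕ) : ℝ)) * p ^ 2 ≤
      ∑ e ∈ Finset.range (m - 1), (n₂ - ((N - (e + 1) : ℕ) : ℝ)) * J e :=
    calc _ ≤ ∑ e ∈ Finset.range D, (n₂ - ((N - (e + 1) : ℕ) : ℝ)) * J e :=
          Finset.sum_le_sum fun e he => mul_le_mul_of_nonneg_left
            (hJp e (by have := Finset.mem_range.1 he; omega)) (hterm e)
      _ ≤ _ := Finset.sum_le_sum_of_subset_of_nonneg (Finset.range_subset_range.2 (by omega))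
            fun e _ _ => mul_nonneg (hterm e) (hJ e)
  have h2 : (N : ℝ) ^ 2 ≤ 2 * (m * (2 * N - m - 1)) + (2 * (D * n₂) - D * (2 * N - 1 - D)) := by
    -- Coordinates vanishing at the extreme case of the constraints `m + 3 ≤ 2 * N` and `N + 1 ≤ m`;
    -- after `D` is replaced by its lower bound `(m - 2) / 3`, the difference has nonnegative
    -- coefficients in `t` and `u`.
    obtain ⟨t, ht⟩ : ∃ t : ℝ, t = 2 * N - m - 3 := ⟨_, rfl⟩
    obtain ⟨u, hu⟩ : ∃ u : ℝ, u = m - N - 1 := ⟨_, rfl⟩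
    have ht0 : 0 ≤ t := by linarith
    have hu0 : 0 ≤ u := by linarith
    have hNe : (N : ℝ) = 4 + u + t := by linarith
    have hme : (m : ℝ) = 5 + 2 * u + t := by linarith
    have hc : (0 : ℝ) ≤ 2 * n₂ - 2 * N + 1 := by linarith
    have hDD : ((m - 2) / 3 : ℝ) * (2 * n₂ - 2 * N + 1 + (m - 2) / 3) ≤
        D * (2 * n₂ - 2 * N + 1 + D) :=
      mul_le_mul (by linarith) (by linarith) (by linarith) (Nat.cast_nonneg D)
    have hpoly : (N : ℝ) ^ 2 ≤ 2 * (m * (2 * N - m - 1)) +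
        (m - 2) / 3 * (2 * n₂ - 2 * N + 1 + (m - 2) / 3) := by
      rw [hn₂, hNe, hme, ← sub_nonneg]
      ring_nf
      positivity
    linarith
  have h3 : (N : ℝ) ^ 2 * p ^ 2 ≤
      (2 * (m * (2 * N - m - 1)) + (2 * (D * n₂) - D * (2 * N - 1 - D))) * p ^ 2 :=
    mul_le_mul_of_nonneg_right h2 (sq_nonneg p)
  rw [← Finset.sum_mul, Finset.sum_sub_distrib] at h1
  simp only [Finset.sum_const, Finset.card_range, nsmul_eq_mul, sub_mul, Finset.sum_sub_distrib]
    at h1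
  rw [← Finset.mul_sum] at h1
  simp only [mul_add, Finset.sum_add_distrib]
  rw [← Finset.sum_mul]
  rw [← hDs] at h3
  have h4 : 2 * ((∑ e ∈ Finset.range (m - 1), ((N - (e + 1) : ℕ) : ℝ)) * p ^ 2) =
      (N * (N - 1)) * p ^ 2 := by rw [← hs]; ring
  nlinarith
-- The exceptional case of pattern length 2 and three letters.
theorem numOcc_two_three (σ : Equiv.Perm (Fin 3)) :
    numOcc (incPattern 2) σ =
      occ (incPattern 2) σ (0 : Fin 2) + occ (incPattern 2) σ (1 : Fin 2) :=
  Fin.sum_univ_two (fun s : Fin 2 => occ (incPattern 2) σ s)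

/-- With `P = 1 / I_3`, the values 0, 1, 2 have probabilities `1 - r + P`, `r - 2 P`, `P`. The
Poisson masses at 0 and 1 are at least `1 - r` and `r (1 - r)`, so the excess is at most `P + (r² -
2 P) + P = r²`; the middle term is nonnegative since `P ≤ r² / 4`. -/
theorem mallows_sub_poisson_two_three_le {q : ℝ} (hq : 0 < q) {r : ℝ≥0}
    (hrm : (r : ℝ) = 2 * (1 / invPoly 2 q)) (A : Set ℕ) :
    ∑ σ : Equiv.Perm (Fin 3), mallowsWeight q σ * A.indicator 1 (numOcc (incPattern 2) σ) -
        (poissonMeasure r).real A ≤ (r : ℝ) ^ 2 := by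
  set x : Equiv.Perm (Fin 3) → ℕ := fun σ => occ (incPattern 2) σ (0 : Fin 2) with hx
  set y : Equiv.Perm (Fin 3) → ℕ := fun σ => occ (incPattern 2) σ (1 : Fin 2) with hy
  have hsx : ∑ σ, mallowsWeight q σ * (x σ : ℝ) = 1 / invPoly 2 q :=
    sum_mallowsWeight_occ (n := 3) (m := 2) hq 0
  have hsy : ∑ σ, mallowsWeight q σ * (y σ : ℝ) = 1 / invPoly 2 q :=
    sum_mallowsWeight_occ (n := 3) (m := 2) hq 1
  have hsxy : ∑ σ, mallowsWeight q σ * ((x σ : ℝ) * y σ) = 1 / invPoly 3 q :=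
    sum_mallowsWeight_occ_mul_occ (n := 3) (m := 2) (i := (0 : Fin 2)) (j := (1 : Fin 2)) hq
      (by decide) (by decide)
  have hs := sum_mallowsWeight 3 hq
  have hP0 : 0 < 1 / invPoly 3 q := one_div_pos.2 (invPoly_pos 3 hq)
  have hP2 : 1 / invPoly 3 q ≤ (1 / invPoly 2 q) ^ 2 := by
    rw [one_div_pow]
    refine one_div_le_one_div_of_le (pow_pos (invPoly_pos 2 hq) 2) ?_
    have h1 : invPoly 3 q = (1 + q) * (1 + q + q ^ 2) := by
      simp [invPoly, Finset.prod_Icc_succ_top, Finset.sum_range_succ]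
    have h2 : invPoly 2 q = 1 + q := by
      simp [invPoly, Finset.prod_Icc_succ_top, Finset.sum_range_succ]
    rw [h1, h2]
    nlinarith [pow_pos hq 2, pow_pos hq 3]
  set a : ℕ → ℝ := A.indicator 1 with ha
  have ha0 : ∀ k, 0 ≤ a k := fun k => Set.indicator_nonneg (fun _ _ => zero_le_one) k
  have ha1 : ∀ k, a k ≤ 1 := fun k => Set.indicator_le_self' (fun _ _ => zero_le_one) k
  have hpt : ∀ σ, a (numOcc (incPattern 2) σ) =
      a 0 * (1 - x σ - y σ + x σ * y σ) + a 1 * (x σ + y σ - 2 * (x σ * y σ)) +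
        a 2 * (x σ * y σ) := by
    intro σ
    rw [numOcc_two_three]
    have hx' : x σ = 0 ∨ x σ = 1 := by simp only [hx]; unfold occ; split_ifs <;> simp
    have hy' : y σ = 0 ∨ y σ = 1 := by simp only [hy]; unfold occ; split_ifs <;> simp
    change a (x σ + y σ) = _
    rcases hx' with h | h <;> rcases hy' with h' | h' <;> rw [h, h'] <;> norm_num
  have hsum : ∑ σ : Equiv.Perm (Fin 3), mallowsWeight q σ * a (numOcc (incPattern 2) σ) =
      a 0 * (1 - r + 1 / invPoly 3 q) + a 1 * (r - 2 * (1 / invPoly 3 q)) +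
        a 2 * (1 / invPoly 3 q) := by
    have : ∀ σ, mallowsWeight q σ * a (numOcc (incPattern 2) σ) =
        a 0 * (mallowsWeight q σ - mallowsWeight q σ * x σ - mallowsWeight q σ * y σ +
          mallowsWeight q σ * (x σ * y σ)) +
        a 1 * (mallowsWeight q σ * x σ + mallowsWeight q σ * y σ -
          2 * (mallowsWeight q σ * (x σ * y σ))) +
        a 2 * (mallowsWeight q σ * (x σ * y σ)) := by
      intro σ
      rw [hpt]; ring
    simp_rw [this, Finset.sum_add_distrib, ← Finset.mul_sum, Finset.sum_add_distrib,
      Finset.sum_sub_distrib, Finset.sum_add_distrib, ← Finset.mul_sum]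
    rw [hs, hsx, hsy, hsxy, hrm]
    ring
  have hexp := Real.add_one_le_exp (-(r : ℝ))
  have hr0 : (0 : ℝ) ≤ r := r.2
  have hpi : a 0 * (1 - r) + a 1 * (r * (1 - r)) ≤ (poissonMeasure r).real A := by
    have h := sum_le_hasSum {0, 1} (fun k _ => Set.indicator_nonneg
      (fun _ _ => measureReal_nonneg) k) (hasSum_indicator_real_singleton (poissonMeasure r) A)
    have hind : ∀ k, A.indicator (fun k => (poissonMeasure r).real {k}) k =
        a k * (poissonMeasure r).real {k} := by
      intro k; by_cases hk : k ∈ A <;> simp [ha, hk]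
    rw [Finset.sum_pair zero_ne_one, hind, hind, poissonMeasure_real_singleton,
      poissonMeasure_real_singleton] at h
    refine le_trans (add_le_add ?_ ?_) h
    · refine mul_le_mul_of_nonneg_left ?_ (ha0 0)
      simp
      linarith
    · refine mul_le_mul_of_nonneg_left ?_ (ha0 1)
      simp
      nlinarith
  rw [hsum]
  have hr2 : (r : ℝ) ^ 2 = 4 * (1 / invPoly 2 q) ^ 2 := by rw [hrm]; ring
  have b0 := mul_le_mul_of_nonneg_right (ha1 0) hP0.le
  have b2 := mul_le_mul_of_nonneg_right (ha1 2) hP0.le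
  have b1 := mul_le_mul_of_nonneg_right (ha1 1)
    (by linarith : 0 ≤ (r : ℝ) ^ 2 - 2 * (1 / invPoly 3 q))
  linarith

/-! ### Transfer to the random permutation and conclusion. -/

theorem sum_Icc_one_div_invPoly {m : ℕ} (hm : 1 ≤ m) (q : ℝ) :
    ∑ s ∈ Finset.Icc 1 (m - 1), 1 / invPoly (2 * m - s) q =
      ∑ e ∈ Finset.range (m - 1), 1 / invPoly (m + (e + 1)) q := by
  refine Finset.sum_nbij' (fun s => m - s - 1) (fun e => m - e - 1) ?_ ?_ ?_ ?_ ?_ <;>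
    intro s hs <;> simp only [Finset.mem_Icc, Finset.mem_range] at hs ⊢
  any_goals omega
  rw [show 2 * m - s = m + (m - s - 1 + 1) by omega]

theorem integral_comp_eq_sum {Ω : Type*} [MeasurableSpace Ω] {P : Measure Ω}
    [IsProbabilityMeasure P] {q : ℝ} {n : ℕ} {Sig : Ω → Equiv.Perm (Fin n)}
    (hSig : IsMallows P q Sig) (g : Equiv.Perm (Fin n) → ℝ) :
    ∫ ω, g (Sig ω) ∂P = ∑ σ, mallowsWeight q σ * g σ := by
  let _ : MeasurableSpace (Equiv.Perm (Fin n)) := ⊤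
  have hmeas : Measurable Sig := measurable_to_countable' fun σ => hSig.measurableSet_eq σ
  have : IsProbabilityMeasure (P.map Sig) := Measure.isProbabilityMeasure_map hmeas.aemeasurable
  rw [← integral_map (f := g) hmeas.aemeasurable (Measurable.of_discrete).aestronglyMeasurable,
    integral_fintype (Integrable.of_finite)]
  refine Finset.sum_congr rfl fun σ _ => ?_
  rw [map_measureReal_apply hmeas MeasurableSet.of_discrete, smul_eq_mul, mallowsWeight,
    ← hSig.prob_eq σ]
  rfl

theorem measurable_comp {Ω : Type*} [MeasurableSpace Ω] {P : Measure Ω} {q : ℝ} {n : ℕ}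
    {Sig : Ω → Equiv.Perm (Fin n)} (hSig : IsMallows P q Sig) (g : Equiv.Perm (Fin n) → ℕ) :
    Measurable fun ω => g (Sig ω) := by
  let _ : MeasurableSpace (Equiv.Perm (Fin n)) := ⊤
  have hmeas : Measurable Sig := measurable_to_countable' fun σ => hSig.measurableSet_eq σ
  exact (Measurable.of_discrete (f := g)).comp hmeas

end MallowsPattern
end

theorem mainTheorem7 {Ω : Type*} [MeasurableSpace Ω] (P : Measure Ω) [IsProbabilityMeasure P]
    (q : ℝ) (hq : 0 < q) (n m : ℕ) (hm : 2 ≤ m) (hn : 2 * m ≤ n + 1 ∨ 3 * m < 2 * n)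
    (Sig : Ω → Equiv.Perm (Fin n)) (hSig : MallowsPattern.IsMallows P q Sig)
    (W : Ω → ℕ)
    (hW : ∀ ω, W ω = MallowsPattern.numOcc (MallowsPattern.incPattern m) (Sig ω))
    (n₁ n₂ b₁ b₂ : ℝ)
    (hn₁ : n₁ = 2 * m * n - 3 * m ^ 2 + m)
    (hn₂ : n₂ = 3 * m - 3 * m ^ 2 - 2 * n + 2 * m * n)
    (hb₁ : b₁ = n₁ / MallowsPattern.invPoly m q ^ 2)
    (hb₂ : b₂ = n₂ * ∑ s ∈ Finset.Icc 1 (m - 1), 1 / MallowsPattern.invPoly (2 * m - s) q) :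
    ∃ lam : ℝ≥0,
      (lam : ℝ) = ∫ ω, (W ω : ℝ) ∂P ∧
      (lam : ℝ) = ((n : ℝ) - m + 1) / MallowsPattern.invPoly m q ∧
      MallowsPattern.tvDist (P.map W) (poissonMeasure lam) ≤ 2 * (b₁ + b₂) := by
  open MallowsPattern in
  obtain rfl : W = fun ω => numOcc (incPattern m) (Sig ω) := funext hW
  have hI := invPoly_pos m hq
  have hN : ((n + 1 - m : ℕ) : ℝ) = n - m + 1 := by
    rw [Nat.cast_sub (by omega)]; push_cast; ring
  have hN0 : 0 < ((n + 1 - m : ℕ) : ℝ) := by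
    have : 0 < n + 1 - m := by omega
    exact_mod_cast this
  obtain ⟨lam, hlam⟩ : ∃ lam : ℝ≥0, (lam : ℝ) = ((n + 1 - m : ℕ) : ℝ) * (1 / invPoly m q) :=
    ⟨⟨_, by positivity⟩, rfl⟩
  have hlam0 : 0 < lam := by
    rw [← NNReal.coe_pos, hlam]; positivity
  refine ⟨lam, ?_, by rw [hlam, hN]; ring, ?_⟩
  · rw [integral_comp_eq_sum hSig fun σ => (numOcc (incPattern m) σ : ℝ), hlam]
    simp only [numOcc, Nat.cast_sum, Finset.mul_sum]
    rw [Finset.sum_comm]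
    simp [sum_mallowsWeight_occ hq]
  have hWm := measurable_comp hSig fun σ => numOcc (incPattern m) σ
  have : IsProbabilityMeasure (P.map fun ω => numOcc (incPattern m) (Sig ω)) :=
    Measure.isProbabilityMeasure_map hWm.aemeasurable
  refine tvDist_le_of_forall _ _ fun A => ?_
  have hA : (P.map fun ω => numOcc (incPattern m) (Sig ω)).real A =
      ∑ σ : Equiv.Perm (Fin n), mallowsWeight q σ * A.indicator 1 (numOcc (incPattern m) σ) := by
    rw [← integral_comp_eq_sum hSig fun σ => A.indicator (1 : ℕ → ℝ) (numOcc (incPattern m) σ),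
      map_measureReal_apply hWm MeasurableSet.of_discrete,
      ← integral_indicator_one (hWm MeasurableSet.of_discrete)]
    rfl
  rw [hA]
  have hn' : (n : ℝ) = ((n + 1 - m : ℕ) : ℝ) + m - 1 := by rw [hN]; ring
  -- In terms of `N = n + 1 - m`, `n₁ = m (2 N - m - 1)` and `n₂ = (m - 1) (2 N - m - 2)`.
  have hb : 2 * (b₁ + b₂) = 2 * (m * (2 * ((n + 1 - m : ℕ) : ℝ) - m - 1) * (1 / invPoly m q) ^ 2 +
      (m - 1) * (2 * ((n + 1 - m : ℕ) : ℝ) - m - 2) *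
        ∑ e ∈ Finset.range (m - 1), 1 / invPoly (m + (e + 1)) q) := by
    rw [hb₁, hb₂, hn₁, hn₂, sum_Icc_one_div_invPoly (by omega), hn']
    ring
  -- Here `n₂ = 0`, so the general estimate, which contains a positive multiple of `1 / I_3`, is too
  -- weak.
  by_cases h22 : m = 2 ∧ n + 1 - m = 2
  · obtain ⟨rfl, h⟩ := h22
    obtain rfl : n = 3 := by omega
    refine (mallows_sub_poisson_two_three_le hq (by rw [hlam]; norm_num) A).trans (le_of_eq ?_)
    rw [hb, hlam]
    norm_num
    ring
  · refine (mallows_sub_poisson_le (by omega) hq hlam0 hlam A).trans ?_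
    rw [hb]
    have hJ : ∀ e, 0 ≤ 1 / invPoly (m + (e + 1)) q := fun e =>
      (one_div_pos.2 (invPoly_pos _ hq)).le
    by_cases hle : m ≤ n + 1 - m
    · exact error_le_of_le hm hle h22 hJ
    · refine error_le_of_lt (by omega) (by omega) hJ fun e he => ?_
      rw [one_div_pow]
      exact one_div_le_one_div_of_le (invPoly_pos _ hq) (invPoly_add_le_sq hq he)
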